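/- Let $d,m\in\mathbb N_+$, $\alpha>d$, $\xi=d/\alpha$, and consider the following multicast network in $\mathbb R^d$. A typical transmitter at the origin multicasts to a Poisson process of intended receivers of intensity $\lambda_r>0$ in its cluster, the ball of radius $s\ge 1$ and volume $\mu_r$; so $k=\mu_r\lambda_r$ is the mean number of intended receivers. Up to $\tau\ge 1$ transmission attempts are allowed. In each attempt the interfering transmitters form a stationary Poisson point process of intensity $\lambda_t>0$, all power gains are i.i.d. Nakagami-$m$ gains of mean $1$ (Gamma distributed with shape $m$ and rate $m$), and different attempts are independent. The interference in one attempt is $I=\sum_{i}\tilde H_i\|X_i\|^{-\alpha}$ over the interferers $X_i$ with gains $\tilde H_i$, where $\|x\|^{-\alpha}$ is replaced by $0$ if $|x|<1$. A receiver at distance $r$ from the transmitter is connected in an attempt with gain $H$ if $H\ge\beta r^{\alpha}I$, where $\beta>0$ is the target signal-to-interference ratio; $\lambda_c(r,\tau)$ is $\lambda_r$ times the probability that it is connected in at least one of the $\tau$ attempts, i.e. $\lambda_c(r,\tau)=\lambda_r\bigl(1-\mathbb P[H<\beta r^\alpha I]^{\tau}\bigr)$. Let $R$ have density $d\,r^{d-1}/s^d$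 on $[0,s]$. The multicast outage probability is $1-\exp\{-\mu_r(\lambda_r-\mathbb E_R[\lambda_c(R,\tau)])\}$, and the maximum contention intensity $\bar\lambda_\epsilon$ is the supremum of the $\lambda_t>0$ for which it is at most $\epsilon$. Then, for all $\beta_0>0$ and $0<\epsilon_0<1-e^{-1}$, there are constants $0<c\le C$ depending only on $d,\alpha,m,\beta_0,\epsilon_0$ such that for all $\tau\ge 1$, $s\ge 1$, $\lambda_r>0$, $0<\epsilon\le\epsilon_0$ and $\beta>0$ with $\beta s^{\alpha}\ge\beta_0$ and $k\ge\epsilon^{-(\tau-1)}$, the constraint can be met, $\bar\lambda_\epsilon$ is finite, and $$c\,\frac{\rho\,\tau^2}{\beta^{\xi}\mu_r k^{1/\tau}}\;\le\;\bar\lambda_\epsilon\;\le\; C\,\frac{\rho\,\tau^2}{\beta^{\xi}\mu_r k^{1/\tau}},\qquad \rho=\frac{(\epsilon(\tau+1))^{1/\tau}}{\tau^2},$$ that is, $\bar\lambda_\epsilon=\Theta\bigl(\rho\tau^2/(\beta^\xi\mu_r k^{1/\tau})\bigr)$. -/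

import Mathlib

open MeasureTheory ProbabilityTheory
open scoped ENNReal NNReal

noncomputable section

namespace Multicast

/-- `d`-dimensional Euclidean space. -/
abbrev Space (d : ℕ) : Type := EuclideanSpace ℝ (Fin d)

/-- The random measure `N` is a Poisson point process with intensity measure `Λ`: the number of
points in a set `A` of finite intensity is Poisson with mean `Λ A`, and the numbers of points in
pairwise disjoint sets are independent. -/
structure IsPoissonProcess {Ω X : Type*} [MeasurableSpace Ω] [MeasurableSpace X]
    (N : Ω → Measure X) (Λ : Measure X) (P : Measure Ω) : Prop where
  measurable : Measurable N
  hasLaw_count : ∀ A : Set X, MeasurableSet A → Λ A ≠ ∞ →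
    HasLaw (fun ω => N ω A)
      ((poissonMeasure (Λ A).toNNReal).map (fun n : ℕ => (n : ℝ≥0∞))) P
  iIndepFun_count : ∀ (n : ℕ) (A : Fin n → Set X), (∀ i, MeasurableSet (A i)) →
    (∀ i j, i ≠ j → Disjoint (A i) (A j)) → iIndepFun (fun i ω => N ω (A i)) P

/-- Law of a Nakagami-`m` fading power gain: the Gamma distribution with shape `m` and rate `m`
(so the mean is `1`). -/
def nakagamiGain (m : ℕ) : Measure ℝ := gammaMeasure m m

/-- Path loss of interfering signals, cut off in the near field. -/
def pathLoss {d : ℕ} (α : ℝ) (x : Space d) : ℝ :=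
  if 1 ≤ ‖x‖ then ‖x‖ ^ (-α) else 0

/-- What the typical cluster (with transmitter at the origin) experiences. In attempt `i`,
`gain i` is the power gain from the transmitter to an intended receiver, and, if the transmitter
intensity is `lam`, `interferers lam i` is the point process of the pairs (location of an
interfering transmitter, power gain from it to the receiver). The interferers are a stationary
Poisson process of intensity `lam`, marked with i.i.d. Nakagami-`m` gains, independent of the
gain of the useful signal, and the attempts are independent and identically distributed. -/
structure Network (Ω : Type*) [MeasurableSpace Ω] (P : Measure Ω) (d m : ℕ) where
  gain : ℕ → Ω → ℝ
  interferers : ℝ → ℕ → Ω → Measure (Space d × ℝ)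
  measurable_gain : ∀ i, Measurable (gain i)
  hasLaw_gain : ∀ i, HasLaw (gain i) (nakagamiGain m) P
  isPoissonProcess : ∀ lam : ℝ, 0 < lam → ∀ i,
    IsPoissonProcess (interferers lam i)
      (ENNReal.ofReal lam • (volume : Measure (Space d)).prod (nakagamiGain m)) P
  indepFun : ∀ lam : ℝ, 0 < lam → ∀ i, IndepFun (gain i) (interferers lam i) P
  iIndepFun_attempts : ∀ lam : ℝ, 0 < lam →
    iIndepFun (fun i ω => (gain i ω, interferers lam i ω)) P

/-- Volume `μ_r` of a cluster, a ball of radius `s`. -/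
def clusterVolume (d : ℕ) (s : ℝ) : ℝ :=
  (volume : Measure (Space d)).real (Metric.ball 0 s)

/-- `ρ = (ε (τ + 1)) ^ (1 / τ) / τ ^ 2`. -/
def rho (ε : ℝ) (τ : ℕ) : ℝ := (ε * (τ + 1)) ^ (1 / (τ : ℝ)) / (τ : ℝ) ^ 2

namespace Network

variable {Ω : Type*} [MeasurableSpace Ω] {P : Measure Ω} {d m : ℕ}

/-- The shot noise `∑ H_x ‖x‖^(-α)` over the interferers in attempt `i`. -/
def interference (net : Network Ω P d m) (α lam : ℝ) (i : ℕ) (ω : Ω) : ℝ≥0∞ :=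
  ∫⁻ z, ENNReal.ofReal (z.2 * pathLoss α z.1) ∂(net.interferers lam i ω)

/-- A receiver at distance `r` from the transmitter is connected in one of the first `τ` attempts:
in some attempt `H r^(-α) ≥ β I`. -/
def connectedEvent (net : Network Ω P d m) (α β lam : ℝ) (τ : ℕ) (r : ℝ) : Set Ω :=
  {ω | ∃ i < τ, ENNReal.ofReal (β * r ^ α) * net.interference α lam i ω
    ≤ ENNReal.ofReal (net.gain i ω)}

/-- Intensity `λ_c(r, τ)` of the connected receivers at distance `r`, where `lamr` is the
intensity `λ_r` of the intended receivers. -/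
def connectedIntensity (net : Network Ω P d m) (α β lam lamr : ℝ) (τ : ℕ) (r : ℝ) : ℝ :=
  lamr * P.real (net.connectedEvent α β lam τ r)

/-- `E_R[λ_c(R, τ)]`, where `R` has density `d r^(d-1) / s^d` on `[0, s]`. -/
def meanConnectedIntensity (net : Network Ω P d m) (α β s lam lamr : ℝ) (τ : ℕ) : ℝ :=
  ∫ r in (0 : ℝ)..s, net.connectedIntensity α β lam lamr τ r * (d * r ^ (d - 1) / s ^ d)

/-- Multicast outage probability `1 - exp (-μ_r (λ_r - E_R[λ_c(R, τ)]))`. -/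
def outageProb (net : Network Ω P d m) (α β s lam lamr : ℝ) (τ : ℕ) : ℝ :=
  1 - Real.exp (-(clusterVolume d s * (lamr - net.meanConnectedIntensity α β s lam lamr τ)))

/-- The transmitter intensities that meet the outage constraint. -/
def feasible (net : Network Ω P d m) (α β s lamr : ℝ) (τ : ℕ) (ε : ℝ) : Set ℝ :=
  {lam | 0 < lam ∧ net.outageProb α β s lam lamr τ ≤ ε}

/-- The maximum contention intensity. -/
def maxContentionIntensity (net : Network Ω P d m) (α β s lamr : ℝ) (τ : ℕ) (ε : ℝ) : ℝ :=
  sSup (net.feasible α β s lamr τ ε)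

end Network

end Multicast

end

/-! Write `k = μ_r λ_r` and let `p(x)` be the failure probability of one attempt when the required
ratio at unit distance is `x = β r ^ α`. By independence a receiver at distance `r` misses all
attempts with probability `p ^ τ`, and the outage constraint becomes `k * E[p(β R ^ α) ^ τ] ≤ -log
(1 - ε)`, whose right side is of order `ε`. If `p(x)` is of order `λ_t x ^ ξ`, then `p` is of order
`λ_t β ^ ξ R ^ d`; since `E[(R ^ d) ^ τ] = (s ^ d) ^ τ / (τ + 1)`, solving for `λ_t` gives `(ε (τ +
1) / k) ^ (1 / τ) / (β ^ ξ s ^ d)`, which is the claimed order.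

The bound `p ≤ C λ_t x ^ ξ` (`exists_measure_failureEvent_le`) comes from Campbell's formula and
scaling, and makes an explicit intensity feasible (`mem_feasible_of_failure_le`). From below, one
strong interferer already causes failure (`exists_le_measure_failureEvent`), which gives `p ≥ (1 -
w) (1 - exp (-c λ_t x ^ ξ))` for `x` bounded away from `0`.

This lower bound is linear in `λ_t` only before it saturates. Saturation would push the mean of `p ^
τ` above `η ^ τ`, where `η = -log (1 - ε₀) < 1`, while `k ≥ ε ^ (-(τ - 1))` and `η ≥ ε` give `k η ^
τ ≥ -log (1 - ε)`; so it is infeasible (`le_inv_of_mem_feasible`), and `le_of_mem_feasible` works in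
the linear regime. For constants free of `τ`, every loss is kept inside a `τ`-th power. -/

/-! ### Poisson and Gamma laws. -/

lemma lintegral_natCast_poissonMeasure (r : ℝ≥0) :
    ∫⁻ n, (n : ℝ≥0∞) ∂poissonMeasure r = r := by
  have hterm (n : ℕ) : ENNReal.ofReal (Real.exp (-r) * r ^ (n + 1) / (n + 1).factorial) *
      ((n + 1 : ℕ) : ℝ≥0∞) =
      r * ENNReal.ofReal (Real.exp (-r) * r ^ n / n.factorial) := by
    rw [← ENNReal.ofReal_natCast, ← ENNReal.ofReal_mul (by positivity),
      ← ENNReal.ofReal_coe_nnreal, ← ENNReal.ofReal_mul (by positivity)]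
    congr 1
    rw [Nat.factorial_succ]
    push_cast
    field_simp
    ring
  have hsum := hasSum_one_poissonMeasure r
  rw [poissonMeasure, lintegral_sum_measure]
  simp only [lintegral_smul_measure, lintegral_dirac, smul_eq_mul]
  rw [tsum_eq_zero_add' ENNReal.summable]
  simp only [hterm]
  rw [ENNReal.tsum_mul_left, ← ENNReal.ofReal_tsum_of_nonneg (fun n => by positivity) hsum.summable,
    hsum.tsum_eq]
  simp

/-- Needed for `q = 1` and for `q = -ξ`; in the latter case `ξ < 1 ≤ m` keeps the density integrable
at `0`. -/
lemma ProbabilityTheory.lintegral_ofReal_rpow_gammaMeasure_lt_top {a r q : ℝ} (ha : 0 < a)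
    (hr : 0 < r) (hq : 0 < a + q) :
    ∫⁻ x, ENNReal.ofReal (|x| ^ q) ∂gammaMeasure a r < ∞ := by
  have hint : IntegrableOn (fun x : ℝ => x ^ (a + q - 1) * Real.exp (-r * x ^ (1 : ℝ)))
      (Set.Ioi 0) :=
    integrableOn_rpow_mul_exp_neg_mul_rpow (by linarith) one_pos hr
  have hint' := (hint.const_mul (r ^ a / Real.Gamma a)).lintegral_lt_top
  rw [gammaMeasure, lintegral_withDensity_eq_lintegral_mul _
    (f := gammaPDF a r) (measurable_gammaPDFReal a r).ennreal_ofReal (by fun_prop)]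
  refine lt_of_le_of_lt ?_ hint'
  rw [← lintegral_indicator measurableSet_Ioi]
  refine lintegral_mono_ae ?_
  filter_upwards [Measure.ae_ne volume (0 : ℝ)] with x hx
  rcases lt_or_gt_of_ne hx with h | h
  · simp [gammaPDF_of_neg h]
  · rw [Set.indicator_of_mem (by exact h), Pi.mul_apply, gammaPDF_of_nonneg h.le,
      ← ENNReal.ofReal_mul (by have := Real.Gamma_pos_of_pos ha; positivity)]
    apply le_of_eq
    congr 1
    rw [abs_of_pos h, show a + q - 1 = (a - 1) + q by ring, Real.rpow_add h, Real.rpow_one]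
    ring_nf

lemma ProbabilityTheory.gammaMeasure_Iic_zero {a r : ℝ} : gammaMeasure a r (Set.Iic 0) = 0 := by
  rw [gammaMeasure, withDensity_apply _ measurableSet_Iic, setLIntegral_congr Iio_ae_eq_Iic.symm,
    lintegral_gammaPDF_of_nonpos le_rfl]

lemma ProbabilityTheory.gammaMeasure_Ioi_pos {a r G : ℝ} (ha : 0 < a) (hr : 0 < r) (hG : 0 < G) :
    0 < gammaMeasure a r (Set.Ioi G) := by
  rw [gammaMeasure, withDensity_apply _ measurableSet_Ioi, setLIntegral_pos_iff
    (f := gammaPDF a r) (measurable_gammaPDFReal a r).ennreal_ofReal]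
  refine lt_of_lt_of_le ?_ (measure_mono (s := Set.Ioi G) ?_)
  · simp
  · intro x hx
    refine ⟨?_, hx⟩
    simpa [gammaPDF] using gammaPDFReal_pos ha hr (hG.trans hx)

/-! ### Campbell's formula and tails of Poisson shot noise. -/

namespace Multicast.IsPoissonProcess

variable {Ω X : Type*} [MeasurableSpace Ω] [MeasurableSpace X] {N : Ω → Measure X}
  {Λ : Measure X} {P : Measure Ω}

lemma lintegral_count (hN : IsPoissonProcess N Λ P) {A : Set X} (hA : MeasurableSet A)
    (hΛ : Λ A ≠ ∞) : ∫⁻ ω, N ω A ∂P = Λ A := by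
  have h := (hN.hasLaw_count A hA hΛ).lintegral_comp (f := fun x => x) (by fun_prop)
  rw [h, lintegral_map (f := fun x => x) (by fun_prop) (by fun_prop),
    lintegral_natCast_poissonMeasure, ENNReal.coe_toNNReal hΛ]

lemma bind_eq [SigmaFinite Λ] (hN : IsPoissonProcess N Λ P) : P.bind N = Λ := by
  rw [Measure.ext_iff_of_iUnion_eq_univ (iUnion_spanningSets Λ)]
  intro i
  ext A hA
  have hAi : MeasurableSet (A ∩ spanningSets Λ i) := hA.inter (measurableSet_spanningSets Λ i)
  rw [Measure.restrict_apply hA, Measure.restrict_apply hA,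
    Measure.bind_apply hAi hN.measurable.aemeasurable]
  exact hN.lintegral_count hAi
    (measure_mono (Set.inter_subset_right) |>.trans_lt (measure_spanningSets_lt_top Λ i)).ne

/-- Campbell's formula. -/
lemma lintegral_lintegral [SigmaFinite Λ] (hN : IsPoissonProcess N Λ P) {f : X → ℝ≥0∞}
    (hf : Measurable f) : ∫⁻ ω, ∫⁻ x, f x ∂N ω ∂P = ∫⁻ x, f x ∂Λ := by
  rw [← Measure.lintegral_bind hN.measurable.aemeasurable hf.aemeasurable, hN.bind_eq]

/-- `IsPoissonProcess` prescribes laws of counts and does not ask each `N ω` to be a counting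
measure; integrality is recovered almost surely, one set at a time. -/
lemma ae_count_eq_zero_or_one_le (hN : IsPoissonProcess N Λ P) {A : Set X} (hA : MeasurableSet A)
    (hΛ : Λ A ≠ ∞) : ∀ᵐ ω ∂P, N ω A = 0 ∨ 1 ≤ N ω A := by
  have hm : MeasurableSet {x : ℝ≥0∞ | x = 0 ∨ 1 ≤ x} :=
    (measurableSet_singleton 0).union measurableSet_Ici
  have h := (hN.hasLaw_count A hA hΛ).ae_iff (p := fun x => x = 0 ∨ 1 ≤ x) hm.mem
  rw [h, ae_map_iff (by fun_prop) hm]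
  refine Filter.Eventually.of_forall fun n => ?_
  rcases Nat.eq_zero_or_pos n with rfl | hn
  · simp
  · exact Or.inr (by exact_mod_cast hn)

lemma measure_one_le_count (hN : IsPoissonProcess N Λ P) {A : Set X} (hA : MeasurableSet A)
    (hΛ : Λ A ≠ ∞) : P {ω | 1 ≤ N ω A} = ENNReal.ofReal (1 - Real.exp (-(Λ A).toReal)) := by
  have h := (hN.hasLaw_count A hA hΛ).measure_eq (p := fun x => 1 ≤ x) measurableSet_Ici
  rw [h, Measure.map_apply (by fun_prop) (show MeasurableSet {x : ℝ≥0∞ | 1 ≤ x} from measurableSet_Ici)]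
  have : (fun n : ℕ => (n : ℝ≥0∞)) ⁻¹' {x | 1 ≤ x} = {0}ᶜ := by
    ext n
    simp [Nat.one_le_iff_ne_zero]
  rw [this, prob_compl_eq_one_sub (measurableSet_singleton 0), poissonMeasure_singleton,
    ENNReal.ofReal_sub _ (Real.exp_nonneg _)]
  simp [ENNReal.toReal]

/-- A union bound for the tail of a shot noise: either there is a point in `B`, or the points
outside `B` contribute a lot. -/
lemma measure_one_lt_lintegral_le [SigmaFinite Λ] (hN : IsPoissonProcess N Λ P) {f : X → ℝ≥0∞}
    (hf : Measurable f) {B : Set X} (hB : MeasurableSet B) (hΛ : Λ B ≠ ∞) :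
    P {ω | 1 < ∫⁻ x, f x ∂N ω} ≤ ∫⁻ x, (B.indicator 1 x + Bᶜ.indicator f x) ∂Λ := by
  have hg : Measurable fun x => B.indicator (1 : X → ℝ≥0∞) x + Bᶜ.indicator f x :=
    (measurable_one.indicator hB).add (hf.indicator hB.compl)
  rw [← hN.lintegral_lintegral hg]
  -- Markov's inequality at level `1`, for the number of points in `B` plus the shot noise from
  -- outside `B`.
  refine le_trans (measure_mono_ae ?_) (meas_ge_le_lintegral_div
    ((Measure.measurable_lintegral hg).comp hN.measurable).aemeasurable one_ne_zero
    ENNReal.one_ne_top |>.trans_eq (by simp))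
  filter_upwards [hN.ae_count_eq_zero_or_one_le hB hΛ] with ω hω h1
  change 1 ≤ ∫⁻ x, (B.indicator (1 : X → ℝ≥0∞) x + Bᶜ.indicator f x) ∂N ω
  rw [lintegral_add_left (measurable_one.indicator hB), lintegral_indicator_one hB,
    lintegral_indicator hB.compl]
  rcases hω with h0 | h0
  · rw [h0, zero_add]
    refine (le_of_lt h1).trans_eq ?_
    rw [← lintegral_add_compl f hB, setLIntegral_measure_zero _ _ h0, zero_add]
  · exact h0.trans le_self_add

end Multicast.IsPoissonProcess

/-! ### Upper bound for the failure probability of an attempt. -/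

namespace Multicast

lemma isProbabilityMeasure_nakagamiGain {m : ℕ} (hm : 0 < m) :
    IsProbabilityMeasure (nakagamiGain m) :=
  isProbabilityMeasure_gammaMeasure (by exact_mod_cast hm) (by exact_mod_cast hm)

lemma lintegral_one_add_abs_nakagamiGain_lt_top {m : ℕ} (hm : 0 < m) :
    ∫⁻ g, ENNReal.ofReal (1 + |g|) ∂nakagamiGain m < ∞ := by
  have := isProbabilityMeasure_nakagamiGain hm
  have hm' : (0 : ℝ) < m := by exact_mod_cast hm
  have h1 := lintegral_ofReal_rpow_gammaMeasure_lt_top (q := 1) hm' hm' (by positivity)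
  simp only [Real.rpow_one] at h1
  simp_rw [ENNReal.ofReal_add zero_le_one (abs_nonneg _)]
  rw [lintegral_add_left (by fun_prop)]
  refine ENNReal.add_lt_top.2 ⟨by simp, h1⟩

@[fun_prop]
lemma measurable_pathLoss {d : ℕ} (α : ℝ) : Measurable (pathLoss (d := d) α) :=
  Measurable.ite (measurableSet_le measurable_const measurable_norm) (by fun_prop)
    measurable_const

lemma lintegral_smul_one_add_norm_rpow {d : ℕ} (α : ℝ) {a : ℝ} (ha : 0 < a) :
    ∫⁻ y : Space d, ENNReal.ofReal (2 ^ α * (1 + ‖a⁻¹ • y‖) ^ (-α)) =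
      ENNReal.ofReal (a ^ d) * ∫⁻ y : Space d, ENNReal.ofReal (2 ^ α * (1 + ‖y‖) ^ (-α)) := by
  have h := Measure.map_addHaar_smul (volume : Measure (Space d)) (inv_ne_zero ha.ne')
  rw [← lintegral_map (μ := (volume : Measure (Space d))) (g := fun y => a⁻¹ • y)
    (f := fun y => ENNReal.ofReal (2 ^ α * (1 + ‖y‖) ^ (-α))) (by fun_prop) (by fun_prop), h,
    lintegral_smul_measure, smul_eq_mul]
  congr 2
  rw [finrank_euclideanSpace, Fintype.card_fin, inv_pow, inv_inv, abs_of_pos (by positivity)]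

lemma lintegral_one_add_norm_rpow_lt_top {d : ℕ} {α : ℝ} (hα : (d : ℝ) < α) :
    ∫⁻ y : Space d, ENNReal.ofReal (2 ^ α * (1 + ‖y‖) ^ (-α)) < ∞ := by
  have : Integrable (fun y : Space d => (1 + ‖y‖) ^ (-α)) :=
    integrable_one_add_norm (by rwa [finrank_euclideanSpace, Fintype.card_fin])
  exact (this.const_mul _).lintegral_lt_top

lemma pathLoss_le {d : ℕ} {α : ℝ} (hα : 0 < α) {a : ℝ} (ha : 0 < a) {y : Space d} (hy : a ≤ ‖y‖) :
    a ^ α * pathLoss α y ≤ 2 ^ α * (1 + ‖a⁻¹ • y‖) ^ (-α) := by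
  have hy0 : 0 < ‖y‖ := ha.trans_le hy
  have h1 : pathLoss α y ≤ ‖y‖ ^ (-α) := by
    unfold pathLoss
    split_ifs
    · exact le_rfl
    · positivity
  refine (mul_le_mul_of_nonneg_left h1 (by positivity)).trans ?_
  have hz : 1 ≤ a⁻¹ * ‖y‖ := by rwa [← div_eq_inv_mul, one_le_div ha]
  rw [norm_smul, norm_inv, Real.norm_of_nonneg ha.le, Real.rpow_neg hy0.le,
    Real.rpow_neg (by positivity), ← div_eq_mul_inv, ← div_eq_mul_inv,
    ← Real.div_rpow ha.le hy0.le, ← Real.div_rpow (by norm_num) (by positivity)]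
  refine Real.rpow_le_rpow (by positivity) ?_ hα.le
  rw [div_le_div_iff₀ hy0 (by positivity)]
  have : a * (a⁻¹ * ‖y‖) = ‖y‖ := by field_simp
  nlinarith

lemma one_le_two_rpow_mul {d : ℕ} {α : ℝ} (hα : 0 < α) {a : ℝ} (ha : 0 < a) {y : Space d}
    (hy : ‖y‖ ≤ a) : 1 ≤ 2 ^ α * (1 + ‖a⁻¹ • y‖) ^ (-α) := by
  have hz : a⁻¹ * ‖y‖ ≤ 1 := by rwa [← div_eq_inv_mul, div_le_one ha]
  rw [norm_smul, norm_inv, Real.norm_of_nonneg ha.le, Real.rpow_neg (by positivity),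
    ← div_eq_mul_inv, ← Real.div_rpow (by norm_num) (by positivity)]
  refine Real.one_le_rpow ?_ hα.le
  rw [one_le_div (by positivity)]
  linarith

/-- A single product majorant serves both inside and outside the ball. It depends on the location
only through `a⁻¹ • z.1`, so its integral scales exactly as `a ^ d`. -/
lemma indicator_add_indicator_pathLoss_le {d : ℕ} {α : ℝ} (hα : 0 < α) {a : ℝ} (ha : 0 < a)
    (z : Space d × ℝ) :
    (Metric.ball (0 : Space d) a ×ˢ (Set.univ : Set ℝ)).indicator (1 : Space d × ℝ → ℝ≥0∞) z +
      (Metric.ball (0 : Space d) a ×ˢ (Set.univ : Set ℝ))ᶜ.indicator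
        (fun z => ENNReal.ofReal (a ^ α) * ENNReal.ofReal (z.2 * pathLoss α z.1)) z ≤
    ENNReal.ofReal (2 ^ α * (1 + ‖a⁻¹ • z.1‖) ^ (-α)) * ENNReal.ofReal (1 + |z.2|) := by
  by_cases hz : z ∈ Metric.ball (0 : Space d) a ×ˢ (Set.univ : Set ℝ)
  · rw [Set.indicator_of_mem hz, Set.indicator_of_notMem (by simpa using hz), add_zero,
      Pi.one_apply]
    have hz' : ‖z.1‖ < a := by simpa using hz
    refine one_le_mul ?_ ?_
    · rw [ENNReal.one_le_ofReal]
      exact one_le_two_rpow_mul hα ha hz'.le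
    · rw [ENNReal.one_le_ofReal]
      linarith [abs_nonneg z.2]
  · have hz' : a ≤ ‖z.1‖ := by simpa using hz
    rw [Set.indicator_of_notMem hz, Set.indicator_of_mem hz, zero_add,
      ← ENNReal.ofReal_mul (by positivity), ← ENNReal.ofReal_mul (by positivity)]
    refine ENNReal.ofReal_le_ofReal ?_
    have h1 := pathLoss_le hα ha hz'
    have h2 : 0 ≤ pathLoss α z.1 := by unfold pathLoss; split_ifs <;> positivity
    calc a ^ α * (z.2 * pathLoss α z.1) = (a ^ α * pathLoss α z.1) * z.2 := by ring
      _ ≤ (a ^ α * pathLoss α z.1) * (1 + |z.2|) := by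
        gcongr
        linarith [le_abs_self z.2]
      _ ≤ _ := by gcongr

namespace Network

variable {Ω : Type*} [MeasurableSpace Ω] {P : Measure Ω} {d m : ℕ}

/-- Attempt `i` fails, where `x` is the signal-to-interference ratio required at unit distance. -/
def failureEvent (net : Network Ω P d m) (α x lam : ℝ) (i : ℕ) : Set Ω :=
  {ω | ENNReal.ofReal (net.gain i ω) < ENNReal.ofReal x * net.interference α lam i ω}

lemma measurable_shotNoise (α : ℝ) : Measurable fun μ : Measure (Space d × ℝ) =>
    ∫⁻ z, ENNReal.ofReal (z.2 * pathLoss α z.1) ∂μ :=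
  Measure.measurable_lintegral (by fun_prop)

lemma measurable_interference (net : Network Ω P d m) (α : ℝ) {lam : ℝ} (hlam : 0 < lam) (i : ℕ) :
    Measurable (net.interference α lam i) :=
  (measurable_shotNoise α).comp (net.isPoissonProcess lam hlam i).measurable

lemma measurableSet_failureEvent (net : Network Ω P d m) (α x : ℝ) {lam : ℝ} (hlam : 0 < lam)
    (i : ℕ) : MeasurableSet (net.failureEvent α x lam i) :=
  measurableSet_lt (net.measurable_gain i).ennreal_ofReal
    ((net.measurable_interference α hlam i).const_mul _)

/-- Conditioning on the useful gain, which is independent of the interference. -/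
lemma measure_failureEvent_eq_lintegral [IsProbabilityMeasure P] (net : Network Ω P d m) (α x : ℝ)
    {lam : ℝ} (hlam : 0 < lam) (i : ℕ) :
    P (net.failureEvent α x lam i) = ∫⁻ h,
      P {ω | ENNReal.ofReal h < ENNReal.ofReal x * net.interference α lam i ω} ∂nakagamiGain m := by
  have hI := net.measurable_interference α hlam i
  have hind : IndepFun (net.gain i) (net.interference α lam i) P :=
    (net.indepFun lam hlam i).comp measurable_id (measurable_shotNoise α)
  rw [indepFun_iff_map_prod_eq_prod_map_map (net.measurable_gain i).aemeasurable
    hI.aemeasurable, (net.hasLaw_gain i).map_eq] at hind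
  have hS : MeasurableSet {p : ℝ × ℝ≥0∞ | ENNReal.ofReal p.1 < ENNReal.ofReal x * p.2} :=
    measurableSet_lt (by fun_prop) (by fun_prop)
  have := Measure.isProbabilityMeasure_map (μ := P) hI.aemeasurable
  have h1 : P (net.failureEvent α x lam i) =
      P.map (fun ω => (net.gain i ω, net.interference α lam i ω))
        {p : ℝ × ℝ≥0∞ | ENNReal.ofReal p.1 < ENNReal.ofReal x * p.2} := by
    rw [Measure.map_apply ((net.measurable_gain i).prodMk hI) hS]
    rfl
  rw [h1, hind, Measure.prod_apply hS]
  refine lintegral_congr fun h => ?_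
  rw [Measure.map_apply hI (measurable_prodMk_left hS)]
  rfl

lemma measure_one_lt_interference_le (net : Network Ω P d m) (hm : 0 < m) {α : ℝ} (hα : 0 < α)
    {lam : ℝ} (hlam : 0 < lam) (i : ℕ) {a : ℝ} (ha : 0 < a) :
    P {ω | 1 < ENNReal.ofReal (a ^ α) * net.interference α lam i ω} ≤
      ENNReal.ofReal lam * (ENNReal.ofReal (a ^ d) *
        (∫⁻ y : Space d, ENNReal.ofReal (2 ^ α * (1 + ‖y‖) ^ (-α))) *
        ∫⁻ g, ENNReal.ofReal (1 + |g|) ∂nakagamiGain m) := by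
  have := isProbabilityMeasure_nakagamiGain hm
  have hN := net.isPoissonProcess lam hlam i
  have hB : MeasurableSet (Metric.ball (0 : Space d) a ×ˢ (Set.univ : Set ℝ)) :=
    Metric.isOpen_ball.measurableSet.prod .univ
  have hΛ : (ENNReal.ofReal lam • (volume : Measure (Space d)).prod (nakagamiGain m))
      (Metric.ball (0 : Space d) a ×ˢ (Set.univ : Set ℝ)) ≠ ∞ := by
    rw [Measure.smul_apply, Measure.prod_prod, smul_eq_mul]
    exact ENNReal.mul_ne_top ENNReal.ofReal_ne_top
      (ENNReal.mul_ne_top measure_ball_lt_top.ne (measure_ne_top _ _))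
  have : SigmaFinite (ENNReal.ofReal lam • (volume : Measure (Space d)).prod (nakagamiGain m)) :=
    inferInstanceAs (SigmaFinite (lam.toNNReal • (volume : Measure (Space d)).prod (nakagamiGain m)))
  have hf : Measurable fun z : Space d × ℝ =>
    ENNReal.ofReal (a ^ α) * ENNReal.ofReal (z.2 * pathLoss α z.1) := by fun_prop
  have h := hN.measure_one_lt_lintegral_le hf hB hΛ
  simp_rw [lintegral_const_mul' _ _ (ENNReal.ofReal_ne_top (r := a ^ α))] at h
  refine h.trans ?_
  rw [lintegral_smul_measure, smul_eq_mul, ← lintegral_smul_one_add_norm_rpow α ha,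
    ← lintegral_prod_mul (by fun_prop) (by fun_prop)]
  gcongr with z
  exact indicator_add_indicator_pathLoss_le hα ha z

end Network

/-- The failure probability of an attempt is at most of order `λ_t x ^ ξ`. -/
lemma exists_measure_failureEvent_le {d m : ℕ} (hm : 0 < m) {α : ℝ}
    (hα : (d : ℝ) < α) : ∃ C : ℝ, 0 < C ∧ ∀ (Ω : Type*) [MeasurableSpace Ω] (P : Measure Ω)
      [IsProbabilityMeasure P] (net : Network Ω P d m) (lam x : ℝ) (i : ℕ), 0 < lam → 0 < x →
      P.real (net.failureEvent α x lam i) ≤ C * (lam * x ^ (d / α)) := by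
  have hα0 : 0 < α := (Nat.cast_nonneg d).trans_lt hα
  have hm' : (1 : ℝ) ≤ m := by exact_mod_cast hm
  set K := ∫⁻ y : Space d, ENNReal.ofReal (2 ^ α * (1 + ‖y‖) ^ (-α)) with hK
  set G := ∫⁻ g, ENNReal.ofReal (1 + |g|) ∂nakagamiGain m with hG
  set M := ∫⁻ h, ENNReal.ofReal (|h| ^ (-(d / α))) ∂nakagamiGain m with hM
  have hKt : K ≠ ∞ := (lintegral_one_add_norm_rpow_lt_top hα).ne
  have hGt : G ≠ ∞ := (lintegral_one_add_abs_nakagamiGain_lt_top hm).ne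
  have hξ : d / α < 1 := by rwa [div_lt_one hα0]
  have hMt : M ≠ ∞ := (lintegral_ofReal_rpow_gammaMeasure_lt_top (by linarith) (by linarith)
    (by linarith)).ne
  -- The `+ 1` only makes positivity of the constant immediate.
  refine ⟨(K * G * M).toReal + 1, by positivity, ?_⟩
  intro Ω _ P _ net lam x i hlam hx
  have key : P (net.failureEvent α x lam i) ≤
      ENNReal.ofReal (lam * x ^ (d / α)) * (K * G * M) := by
    rw [net.measure_failureEvent_eq_lintegral α x hlam i]
    have hpt : ∀ᵐ h ∂nakagamiGain m,
        P {ω | ENNReal.ofReal h < ENNReal.ofReal x * net.interference α lam i ω} ≤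
        ENNReal.ofReal (lam * x ^ (d / α)) * (K * G) * ENNReal.ofReal (|h| ^ (-(d / α))) := by
      have h0 : ∀ᵐ h ∂nakagamiGain m, 0 < h := by
        rw [ae_iff]
        simp only [not_lt]
        exact gammaMeasure_Iic_zero
      filter_upwards [h0] with h hh
      -- The radius `a` with `a ^ α = x / h`: failure at gain `h` then means `a ^ α * I > 1`, and `a
      -- ^ d = x ^ ξ * h ^ (-ξ)`.
      have ha : 0 < (x / h) ^ (1 / α) := by positivity
      have haα : ((x / h) ^ (1 / α)) ^ α = x / h := by
        rw [← Real.rpow_mul (by positivity), one_div_mul_cancel hα0.ne', Real.rpow_one]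
      have had : ((x / h) ^ (1 / α)) ^ d = x ^ (d / α) * h ^ (-(d / α)) := by
        rw [← Real.rpow_natCast, ← Real.rpow_mul (by positivity), one_div_mul_eq_div,
          Real.div_rpow hx.le hh.le, Real.rpow_neg hh.le, div_eq_mul_inv]
      have h1 := net.measure_one_lt_interference_le hm hα0 hlam i ha
      rw [haα, had, ← hK, ← hG] at h1
      refine (measure_mono ?_).trans (h1.trans_eq ?_)
      · intro ω hω
        simp only [Set.mem_ofPred_eq] at hω ⊢
        rw [ENNReal.ofReal_div_of_pos hh, ENNReal.div_eq_inv_mul, mul_assoc,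
          ← ENNReal.div_eq_inv_mul]
        rw [ENNReal.lt_div_iff_mul_lt (by simp [hh]) (by simp), one_mul]
        exact hω
      · rw [abs_of_pos hh, ENNReal.ofReal_mul (by positivity), ENNReal.ofReal_mul (by positivity)]
        ring
    refine (lintegral_mono_ae hpt).trans_eq ?_
    rw [lintegral_const_mul _ (by fun_prop), ← hM]
    ring
  have hfin : K * G * M ≠ ∞ := ENNReal.mul_ne_top (ENNReal.mul_ne_top hKt hGt) hMt
  have h2 := ENNReal.toReal_mono (ENNReal.mul_ne_top ENNReal.ofReal_ne_top hfin) key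
  rw [ENNReal.toReal_mul, ENNReal.toReal_ofReal (by positivity)] at h2
  have h3 : 0 < lam * x ^ (d / α) := by positivity
  rw [measureReal_def]
  nlinarith

/-! ### Lower bound for the failure probability of an attempt. -/

lemma exists_nakagamiGain_Iio_gt {m : ℕ} (hm : 0 < m) {w : ℝ} (hw : 0 < w) :
    ∃ M : ℝ, 0 < M ∧ 1 - w < (nakagamiGain m).real (Set.Iio M) := by
  have := isProbabilityMeasure_nakagamiGain hm
  have h := tendsto_cdf_atTop (nakagamiGain m)
  obtain ⟨M, hM, hM0⟩ := ((h.eventually (lt_mem_nhds (show 1 - w < 1 by linarith))).and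
    (Filter.eventually_ge_atTop 0)).exists
  refine ⟨M + 1, by linarith, hM.trans_le ?_⟩
  rw [cdf_eq_real]
  exact measureReal_mono (Set.Iic_subset_Iio.2 (by linarith))

namespace Network

variable {Ω : Type*} [MeasurableSpace Ω] {P : Measure Ω} {d m : ℕ}

/-- One interferer in the annulus with gain above `M * ρ ^ α / x` contributes at least `M / x` to
the interference, enough to defeat a useful gain below `M`. The two events are independent. -/
lemma le_measure_failureEvent [IsProbabilityMeasure P] (net : Network Ω P d m) (hm : 0 < m)
    {α : ℝ} {lam : ℝ} (hlam : 0 < lam) (i : ℕ) {x ρ M : ℝ} (hx : 0 < x) (hM : 0 < M)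
    (hα : 0 < α) (hρ : 1 ≤ ρ) :
    (nakagamiGain m).real (Set.Iio M) * (1 - Real.exp (-(lam *
      ((volume : Measure (Space d)).real (Metric.ball 0 ρ \ Metric.ball 0 1) *
        (nakagamiGain m).real (Set.Ioi (M * ρ ^ α / x)))))) ≤
      P.real (net.failureEvent α x lam i) := by
  have := isProbabilityMeasure_nakagamiGain hm
  have hN := net.isPoissonProcess lam hlam i
  have hρ0 : 0 < ρ := one_pos.trans_le hρ
  set A : Set (Space d × ℝ) :=
    (Metric.ball 0 ρ \ Metric.ball 0 1) ×ˢ Set.Ioi (M * ρ ^ α / x) with hA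
  have hAm : MeasurableSet A :=
    (Metric.isOpen_ball.measurableSet.diff Metric.isOpen_ball.measurableSet).prod measurableSet_Ioi
  have hvt : (volume : Measure (Space d)) (Metric.ball 0 ρ \ Metric.ball 0 1) ≠ ∞ :=
    ((measure_mono Set.sdiff_subset).trans_lt measure_ball_lt_top).ne
  have hΛ : (ENNReal.ofReal lam • (volume : Measure (Space d)).prod (nakagamiGain m)) A ≠ ∞ := by
    rw [Measure.smul_apply, Measure.prod_prod, smul_eq_mul]
    exact ENNReal.mul_ne_top ENNReal.ofReal_ne_top
      (ENNReal.mul_ne_top hvt (measure_ne_top _ _))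
  have hΛ' : ((ENNReal.ofReal lam • (volume : Measure (Space d)).prod (nakagamiGain m)) A).toReal =
      lam * ((volume : Measure (Space d)).real (Metric.ball 0 ρ \ Metric.ball 0 1) *
        (nakagamiGain m).real (Set.Ioi (M * ρ ^ α / x))) := by
    rw [Measure.smul_apply, Measure.prod_prod, smul_eq_mul, ENNReal.toReal_mul, ENNReal.toReal_mul,
      ENNReal.toReal_ofReal hlam.le]
    rfl
  have hind := (net.indepFun lam hlam i).measure_inter_preimage_eq_mul (Set.Iio M)
    {μ : Measure (Space d × ℝ) | 1 ≤ μ A} measurableSet_Iio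
    (measurableSet_le measurable_const (Measure.measurable_coe hAm))
  have h1 := hN.measure_one_le_count hAm hΛ
  have h2 : P (net.gain i ⁻¹' Set.Iio M) = nakagamiGain m (Set.Iio M) := by
    rw [← (net.hasLaw_gain i).map_eq, Measure.map_apply (net.measurable_gain i) measurableSet_Iio]
  have h3 : net.interferers lam i ⁻¹' {μ : Measure (Space d × ℝ) | 1 ≤ μ A} =
      {ω | 1 ≤ net.interferers lam i ω A} := rfl
  rw [h3, h2, h1, hΛ'] at hind
  have h4 := congrArg ENNReal.toReal hind
  rw [ENNReal.toReal_mul, ENNReal.toReal_ofReal] at h4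
  · refine h4.symm.le.trans (measureReal_mono ?_)
    rintro ω ⟨hg, hc⟩
    have hg' : net.gain i ω < M := hg
    have hc' : 1 ≤ net.interferers lam i ω A := hc
    change ENNReal.ofReal (net.gain i ω) < ENNReal.ofReal x * net.interference α lam i ω
    refine ((ENNReal.ofReal_lt_ofReal_iff hM).2 hg').trans_le ?_
    have h5 : ENNReal.ofReal (M / x) ≤ net.interference α lam i ω := by
      calc ENNReal.ofReal (M / x) ≤ ENNReal.ofReal (M / x) * net.interferers lam i ω A :=
            le_mul_of_one_le_right (by positivity) hc'
        _ = ∫⁻ _ in A, ENNReal.ofReal (M / x) ∂net.interferers lam i ω := by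
            rw [setLIntegral_const]
        _ ≤ ∫⁻ z in A, ENNReal.ofReal (z.2 * pathLoss α z.1) ∂net.interferers lam i ω := by
            refine setLIntegral_mono' hAm fun z hz => ENNReal.ofReal_le_ofReal ?_
            obtain ⟨⟨hz1, hz2⟩, hz3⟩ := hz
            have hz1' : ‖z.1‖ < ρ := by simpa using hz1
            have hz2' : 1 ≤ ‖z.1‖ := by simpa using hz2
            have hz3' : M * ρ ^ α / x < z.2 := hz3
            rw [pathLoss, if_pos hz2']
            have h6 : ρ ^ (-α) ≤ ‖z.1‖ ^ (-α) :=
              Real.rpow_le_rpow_of_nonpos (by linarith) hz1'.le (by linarith)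
            calc M / x = M * ρ ^ α / x * ρ ^ (-α) := by
                  rw [Real.rpow_neg hρ0.le]
                  field_simp
              _ ≤ z.2 * ‖z.1‖ ^ (-α) := by
                  have : 0 < M * ρ ^ α / x := by positivity
                  gcongr
                  linarith
        _ ≤ net.interference α lam i ω := setLIntegral_le_lintegral _ _
    calc ENNReal.ofReal M = ENNReal.ofReal x * ENNReal.ofReal (M / x) := by
          rw [← ENNReal.ofReal_mul hx.le]
          congr 1
          field_simp
      _ ≤ _ := by gcongr
  · have : Real.exp (-(lam * ((volume : Measure (Space d)).real
        (Metric.ball 0 ρ \ Metric.ball 0 1) *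
        (nakagamiGain m).real (Set.Ioi (M * ρ ^ α / x))))) ≤ 1 := by
      rw [Real.exp_le_one_iff, neg_nonpos]
      positivity
    linarith

end Network

/-- Volume of the unit ball. -/
noncomputable def unitBallVolume (d : ℕ) : ℝ := (volume : Measure (Space d)).real (Metric.ball 0 1)

lemma unitBallVolume_pos (d : ℕ) : 0 < unitBallVolume d :=
  ENNReal.toReal_pos (Metric.measure_ball_pos _ _ one_pos).ne' measure_ball_lt_top.ne

lemma clusterVolume_eq {d : ℕ} {s : ℝ} (hs : 0 < s) :
    clusterVolume d s = s ^ d * unitBallVolume d := by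
  rw [clusterVolume, unitBallVolume, measureReal_def, measureReal_def,
    Measure.addHaar_ball_of_pos _ _ hs, finrank_euclideanSpace, Fintype.card_fin,
    ENNReal.toReal_mul, ENNReal.toReal_ofReal (by positivity)]

/-- Away from the near field, the failure probability of an attempt is bounded from below, up to a
factor close to `1`, by the probability that a Poisson process of intensity of order `λ_t` has a
point in a region of volume `x ^ ξ`. -/
lemma exists_le_measure_failureEvent {d m : ℕ} (hd : 0 < d) (hm : 0 < m) {α : ℝ} (hα : 0 < α)
    {w x₀ : ℝ} (hw : 0 < w) (hx₀ : 0 < x₀) :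
    ∃ c : ℝ, 0 < c ∧ ∀ (Ω : Type*) [MeasurableSpace Ω] (P : Measure Ω)
      [IsProbabilityMeasure P] (net : Network Ω P d m) (lam x : ℝ) (i : ℕ), 0 < lam → x₀ ≤ x →
      (1 - w) * (1 - Real.exp (-(c * (lam * x ^ (d / α))))) ≤
        P.real (net.failureEvent α x lam i) := by
  obtain ⟨M, hM, hMw⟩ := exists_nakagamiGain_Iio_gt hm hw
  have := isProbabilityMeasure_nakagamiGain hm
  have hm' : (0 : ℝ) < m := by exact_mod_cast hm
  set G := (nakagamiGain m).real (Set.Ioi (M * 2 ^ α / x₀)) with hG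
  have hGpos : 0 < G := ENNReal.toReal_pos
    (gammaMeasure_Ioi_pos hm' hm' (by positivity)).ne' (measure_ne_top _ _)
  have hv := unitBallVolume_pos d
  refine ⟨unitBallVolume d * x₀ ^ (-(d / α)) * G, by positivity, ?_⟩
  intro Ω _ P _ net lam x i hlam hx
  have hxpos : 0 < x := hx₀.trans_le hx
  have hquot : 1 ≤ x / x₀ := by rwa [one_le_div hx₀]
  -- With outer radius `2 * t`, the gain threshold becomes `M * 2 ^ α / x₀`, free of `x`, while the
  -- annulus has volume of order `x ^ ξ`. The factor `2` leaves room for removing the unit ball, as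
  -- `d ≥ 1` and `t ≥ 1`.
  set t := (x / x₀) ^ (1 / α) with ht
  have ht1 : 1 ≤ t := Real.one_le_rpow hquot (by positivity)
  have htα : t ^ α = x / x₀ := by
    rw [ht, ← Real.rpow_mul (by positivity), one_div_mul_cancel hα.ne', Real.rpow_one]
  have htd : t ^ d = x ^ (d / α) * x₀ ^ (-(d / α)) := by
    rw [ht, ← Real.rpow_natCast, ← Real.rpow_mul (by positivity), one_div_mul_eq_div,
      Real.div_rpow hxpos.le hx₀.le, Real.rpow_neg hx₀.le, div_eq_mul_inv]
  have key := net.le_measure_failureEvent hm hlam i hxpos hM hα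
    (show (1 : ℝ) ≤ 2 * t by linarith)
  have hgain : M * (2 * t) ^ α / x = M * 2 ^ α / x₀ := by
    rw [Real.mul_rpow (by norm_num) (by positivity), htα]
    field_simp
  have hvol : unitBallVolume d * t ^ d ≤
      (volume : Measure (Space d)).real (Metric.ball 0 (2 * t) \ Metric.ball 0 1) := by
    rw [measureReal_sdiff (Metric.ball_subset_ball (by linarith)) Metric.isOpen_ball.measurableSet
      measure_ball_lt_top.ne]
    have h1 := clusterVolume_eq (d := d) (show 0 < 2 * t by linarith)
    rw [clusterVolume] at h1
    rw [h1]
    change _ ≤ _ - unitBallVolume d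
    have h2 : (2 : ℝ) ≤ 2 ^ d := le_self_pow₀ one_le_two hd.ne'
    have h3 : 1 ≤ t ^ d := one_le_pow₀ ht1
    have h4 : 2 * t ^ d ≤ 2 ^ d * t ^ d := by gcongr
    rw [mul_pow]
    nlinarith
  rw [hgain, ← hG] at key
  refine le_trans ?_ key
  have hexp : Real.exp (-(lam * ((volume : Measure (Space d)).real
      (Metric.ball 0 (2 * t) \ Metric.ball 0 1) * G))) ≤
      Real.exp (-(unitBallVolume d * x₀ ^ (-(d / α)) * G * (lam * x ^ (d / α)))) := by
    rw [Real.exp_le_exp, neg_le_neg_iff]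
    calc unitBallVolume d * x₀ ^ (-(d / α)) * G * (lam * x ^ (d / α)) =
          lam * (unitBallVolume d * t ^ d * G) := by rw [htd]; ring
      _ ≤ _ := by gcongr
  have hone : Real.exp (-(unitBallVolume d * x₀ ^ (-(d / α)) * G * (lam * x ^ (d / α)))) ≤ 1 := by
    rw [Real.exp_le_one_iff, neg_nonpos]
    positivity
  exact mul_le_mul hMw.le (by linarith) (by linarith) measureReal_nonneg

/-! ### Averaging the miss probability over the cluster. -/

/-- `R ^ d / s ^ d` is uniform on `[0, 1]`; this is where the factor `τ + 1` of the theorem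
originates. -/
lemma integral_pow_mul_radialDensity {d : ℕ} (hd : 0 < d) (n : ℕ) (κ : ℝ) {s : ℝ} (hs : 0 < s) :
    ∫ r in κ * s..s, (r ^ d) ^ n * (d * r ^ (d - 1) / s ^ d) =
      (s ^ d) ^ n * (1 - κ ^ (d * (n + 1))) / (n + 1) := by
  obtain ⟨e, rfl⟩ : ∃ e, d = e + 1 := ⟨d - 1, by omega⟩
  have h1 (r : ℝ) : (r ^ (e + 1)) ^ n * (((e + 1 : ℕ) : ℝ) * r ^ (e + 1 - 1) / s ^ (e + 1)) =
      ((e + 1 : ℕ) : ℝ) / s ^ (e + 1) * r ^ ((e + 1) * n + e) := by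
    rw [Nat.add_sub_cancel, pow_add r ((e + 1) * n) e, pow_mul r (e + 1) n]
    ring
  simp_rw [h1]
  rw [intervalIntegral.integral_const_mul, integral_pow,
    show (e + 1) * n + e + 1 = (e + 1) * (n + 1) by ring, mul_pow, pow_mul s, pow_succ (s ^ (e + 1))]
  have h2 : (((e + 1) * n + e : ℕ) : ℝ) + 1 = ((e + 1 : ℕ) : ℝ) * (n + 1) := by
    push_cast; ring
  rw [h2]
  have h3 : ((e + 1 : ℕ) : ℝ) ≠ 0 := by positivity
  have h4 : (n : ℝ) + 1 ≠ 0 := by positivity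
  field_simp

namespace Network

variable {Ω : Type*} [MeasurableSpace Ω] {P : Measure Ω} {d m : ℕ}

/-- Probability that a receiver at distance `r` misses the first `τ` attempts. -/
noncomputable def missProb (net : Network Ω P d m) (α β lam : ℝ) (τ : ℕ) (r : ℝ) : ℝ :=
  ∏ i ∈ Finset.range τ, P.real (net.failureEvent α (β * r ^ α) lam i)

/-- Mean of `missProb` over the cluster. -/
noncomputable def meanMissProb (net : Network Ω P d m) (α β s lam : ℝ) (τ : ℕ) : ℝ :=
  ∫ r in (0 : ℝ)..s, net.missProb α β lam τ r * (d * r ^ (d - 1) / s ^ d)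

lemma missProb_nonneg (net : Network Ω P d m) (α β lam : ℝ) (τ : ℕ) (r : ℝ) :
    0 ≤ net.missProb α β lam τ r :=
  Finset.prod_nonneg fun _ _ => measureReal_nonneg

lemma connectedEvent_compl (net : Network Ω P d m) (α β lam : ℝ) (τ : ℕ) (r : ℝ) :
    (net.connectedEvent α β lam τ r)ᶜ =
      ⋂ i ∈ Finset.range τ, net.failureEvent α (β * r ^ α) lam i := by
  ext ω
  simp [connectedEvent, failureEvent]

lemma measure_connectedEvent [IsProbabilityMeasure P] (net : Network Ω P d m) (α β : ℝ) {lam : ℝ}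
    (hlam : 0 < lam) (τ : ℕ) (r : ℝ) :
    P.real (net.connectedEvent α β lam τ r) = 1 - net.missProb α β lam τ r := by
  have hm : MeasurableSet (⋂ i ∈ Finset.range τ, net.failureEvent α (β * r ^ α) lam i) :=
    Finset.measurableSet_biInter _ fun i _ => net.measurableSet_failureEvent α _ hlam i
  have hS : MeasurableSet {p : ℝ × Measure (Space d × ℝ) | ENNReal.ofReal p.1 <
      ENNReal.ofReal (β * r ^ α) * ∫⁻ z, ENNReal.ofReal (z.2 * pathLoss α z.1) ∂p.2} :=
    measurableSet_lt (by fun_prop)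
      (((measurable_shotNoise α).comp measurable_snd).const_mul _)
  have hprod := (net.iIndepFun_attempts lam hlam).meas_biInter (S := Finset.range τ)
    (s := fun i => net.failureEvent α (β * r ^ α) lam i) fun i _ => ⟨_, hS, rfl⟩
  rw [← compl_compl (net.connectedEvent α β lam τ r), connectedEvent_compl,
    probReal_compl_eq_one_sub hm, measureReal_def, hprod, ENNReal.toReal_prod]
  rfl

/-- Monotonicity in `r` is what makes the averages over the cluster integrable, with no
measurability argument in `r`. -/
lemma monotoneOn_missProb [IsProbabilityMeasure P] (net : Network Ω P d m) {α β : ℝ} (hα : 0 < α)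
    (hβ : 0 < β) (lam : ℝ) (τ : ℕ) : MonotoneOn (net.missProb α β lam τ) (Set.Ici 0) := by
  intro r hr r' _ hrr
  refine Finset.prod_le_prod (fun _ _ => measureReal_nonneg) fun i _ => measureReal_mono ?_
  intro ω hω
  refine lt_of_lt_of_le (b := ENNReal.ofReal (β * r ^ α) * net.interference α lam i ω) hω ?_
  have hr0 : 0 ≤ r := hr
  gcongr

lemma intervalIntegrable_missProb [IsProbabilityMeasure P] (net : Network Ω P d m) {α β : ℝ}
    (hα : 0 < α) (hβ : 0 < β) (lam : ℝ) (τ : ℕ) (s : ℝ) {a b : ℝ} (ha : 0 ≤ a) (hab : a ≤ b) :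
    IntervalIntegrable (fun r => net.missProb α β lam τ r * (d * r ^ (d - 1) / s ^ d))
      volume a b := by
  refine IntervalIntegrable.mul_continuousOn ?_ (by fun_prop)
  refine MonotoneOn.intervalIntegrable ((net.monotoneOn_missProb hα hβ lam τ).mono ?_)
  rw [Set.uIcc_of_le hab]
  exact fun x hx => ha.trans hx.1

lemma outageProb_eq [IsProbabilityMeasure P] (net : Network Ω P d m) (hd : 0 < d) {α β : ℝ}
    (hα : 0 < α) (hβ : 0 < β) {s : ℝ} (hs : 0 < s) {lam : ℝ} (hlam : 0 < lam) (lamr : ℝ) (τ : ℕ) :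
    net.outageProb α β s lam lamr τ =
      1 - Real.exp (-(clusterVolume d s * lamr * net.meanMissProb α β s lam τ)) := by
  have h1 (r : ℝ) : net.connectedIntensity α β lam lamr τ r * (d * r ^ (d - 1) / s ^ d) =
      lamr * (d * r ^ (d - 1) / s ^ d) -
        lamr * (net.missProb α β lam τ r * (d * r ^ (d - 1) / s ^ d)) := by
    rw [connectedIntensity, net.measure_connectedEvent α β hlam τ r]
    ring
  have h2 := integral_pow_mul_radialDensity hd 0 0 hs
  simp only [zero_mul, pow_zero, one_mul, zero_add, mul_one, zero_pow hd.ne', sub_zero,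
    Nat.cast_zero, div_one] at h2
  rw [outageProb, meanConnectedIntensity]
  simp_rw [h1]
  rw [intervalIntegral.integral_sub
    (Continuous.intervalIntegrable (by fun_prop) _ _)
    ((net.intervalIntegrable_missProb hα hβ lam τ s le_rfl hs.le).const_mul _),
    intervalIntegral.integral_const_mul, intervalIntegral.integral_const_mul, h2]
  change 1 - Real.exp (-(clusterVolume d s *
    (lamr - (lamr * 1 - lamr * net.meanMissProb α β s lam τ)))) = _
  ring_nf

lemma mem_feasible_iff [IsProbabilityMeasure P] (net : Network Ω P d m) (hd : 0 < d) {α β : ℝ}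
    (hα : 0 < α) (hβ : 0 < β) {s : ℝ} (hs : 0 < s) {lam : ℝ} (lamr : ℝ) (τ : ℕ) {ε : ℝ}
    (hε : ε < 1) :
    lam ∈ net.feasible α β s lamr τ ε ↔
      0 < lam ∧ clusterVolume d s * lamr * net.meanMissProb α β s lam τ ≤ -Real.log (1 - ε) := by
  refine and_congr_right fun hlam => ?_
  rw [net.outageProb_eq hd hα hβ hs hlam, sub_le_comm, ← Real.log_le_iff_le_exp (by linarith),
    le_neg]

lemma meanMissProb_le [IsProbabilityMeasure P] (net : Network Ω P d m) (hd : 0 < d) {α β : ℝ}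
    (hα : 0 < α) (hβ : 0 < β) {s : ℝ} (hs : 0 < s) {lam A : ℝ} {τ : ℕ}
    (h : ∀ r, 0 < r → ∀ i, P.real (net.failureEvent α (β * r ^ α) lam i) ≤ A * r ^ d) :
    net.meanMissProb α β s lam τ ≤ (A * s ^ d) ^ τ / (τ + 1) := by
  have h1 := integral_pow_mul_radialDensity hd τ 0 hs
  rw [zero_mul, zero_pow (by positivity), sub_zero, mul_one] at h1
  calc net.meanMissProb α β s lam τ ≤
        ∫ r in (0 : ℝ)..s, A ^ τ * ((r ^ d) ^ τ * (d * r ^ (d - 1) / s ^ d)) := by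
        refine intervalIntegral.integral_mono_on_of_le_Ioo hs.le
          (net.intervalIntegrable_missProb hα hβ lam τ s le_rfl hs.le)
          (Continuous.intervalIntegrable (by fun_prop) _ _) fun r hr => ?_
        have hr0 : 0 < r := hr.1
        rw [← mul_assoc, ← mul_pow]
        gcongr
        refine (Finset.prod_le_prod (fun _ _ => measureReal_nonneg)
          fun i _ => h r hr0 i).trans_eq ?_
        rw [Finset.prod_const, Finset.card_range]
    _ = _ := by rw [intervalIntegral.integral_const_mul, h1, mul_pow]; ring

/-- Discarding radii below `κ * s` avoids the small `x` where the lower failure bound is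
unavailable. The exponent `n` is `0` in the saturated regime and `τ` in the linear one. -/
lemma le_meanMissProb [IsProbabilityMeasure P] (net : Network Ω P d m) (hd : 0 < d) {α β : ℝ}
    (hα : 0 < α) (hβ : 0 < β) {s : ℝ} (hs : 0 < s) {lam B κ : ℝ} {τ n : ℕ} (hκ : 0 ≤ κ)
    (hκ1 : κ ≤ 1) (hB : 0 ≤ B)
    (h : ∀ r, κ * s ≤ r → r ≤ s → B * (r ^ d) ^ n ≤ net.missProb α β lam τ r) :
    B * (s ^ d) ^ n * (1 - κ) / (n + 1) ≤ net.meanMissProb α β s lam τ := by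
  have h0 : 0 ≤ κ * s := by positivity
  have h1 : κ * s ≤ s := mul_le_of_le_one_left hs.le hκ1
  have h2 : κ ^ (d * (n + 1)) ≤ κ := pow_le_of_le_one hκ hκ1 (by positivity)
  have hnn (r : ℝ) (hr : 0 ≤ r) :
      0 ≤ net.missProb α β lam τ r * (d * r ^ (d - 1) / s ^ d) :=
    mul_nonneg (net.missProb_nonneg ..) (by positivity)
  calc B * (s ^ d) ^ n * (1 - κ) / (n + 1)
      ≤ B * (s ^ d) ^ n * (1 - κ ^ (d * (n + 1))) / (n + 1) := by gcongr
    _ = ∫ r in κ * s..s, B * ((r ^ d) ^ n * (d * r ^ (d - 1) / s ^ d)) := by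
        rw [intervalIntegral.integral_const_mul, integral_pow_mul_radialDensity hd n κ hs]
        ring
    _ ≤ ∫ r in κ * s..s, net.missProb α β lam τ r * (d * r ^ (d - 1) / s ^ d) := by
        refine intervalIntegral.integral_mono_on h1
          (Continuous.intervalIntegrable (by fun_prop) _ _)
          (net.intervalIntegrable_missProb hα hβ lam τ s h0 h1) fun r hr => ?_
        have hr0 : 0 ≤ r := h0.trans hr.1
        rw [← mul_assoc]
        gcongr
        exact h r hr.1 hr.2
    _ ≤ net.meanMissProb α β s lam τ := by
        rw [meanMissProb, ← intervalIntegral.integral_add_adjacent_intervals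
          (net.intervalIntegrable_missProb hα hβ lam τ s le_rfl h0)
          (net.intervalIntegrable_missProb hα hβ lam τ s h0 h1)]
        exact le_add_of_nonneg_left (intervalIntegral.integral_nonneg h0 fun r hr => hnn r hr.1)

lemma pow_le_missProb (net : Network Ω P d m) {α β lam b : ℝ} {τ : ℕ} {r : ℝ} (hb : 0 ≤ b)
    (h : ∀ i, b ≤ P.real (net.failureEvent α (β * r ^ α) lam i)) :
    b ^ τ ≤ net.missProb α β lam τ r := by
  have := Finset.prod_le_prod (s := Finset.range τ) (f := fun _ => b) (fun _ _ => hb)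
    fun i _ => h i
  rwa [Finset.prod_const, Finset.card_range] at this

end Network

/-! ### Elementary inequalities. -/

lemma div_one_add_le_one_sub_exp_neg {y : ℝ} (hy : 0 ≤ y) : y / (1 + y) ≤ 1 - Real.exp (-y) := by
  have h1 := Real.add_one_le_exp y
  have h2 : Real.exp (-y) ≤ 1 / (1 + y) := by
    rw [Real.exp_neg, ← one_div]
    exact one_div_le_one_div_of_le (by linarith) (by linarith)
  have h3 : y / (1 + y) = 1 - 1 / (1 + y) := by field_simp; ring
  linarith

lemma neg_log_one_sub_le {ε : ℝ} (hε : ε < 1) : -Real.log (1 - ε) ≤ ε / (1 - ε) := by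
  have h := Real.one_sub_inv_le_log_of_pos (show 0 < 1 - ε by linarith)
  have : ε / (1 - ε) = -(1 - (1 - ε)⁻¹) := by
    have : 1 - ε ≠ 0 := by linarith
    field_simp
    ring
  linarith

/-- If an outage of level `ε ≤ ε₀ < 1 - e⁻¹` is to be met by `k ≥ ε ^ (-(τ - 1))` receivers, the
probability that all attempts fail must not exceed `(-log (1 - ε₀)) ^ τ`. -/
lemma neg_log_one_sub_le_mul_pow {ε ε₀ k : ℝ} {τ : ℕ} (hτ : 1 ≤ τ) (hε : 0 < ε) (hεε₀ : ε ≤ ε₀)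
    (hε₀ : ε₀ < 1) (hk : 1 / ε ^ (τ - 1) ≤ k) :
    -Real.log (1 - ε) ≤ k * (-Real.log (1 - ε₀)) ^ τ := by
  set η := -Real.log (1 - ε₀) with hη
  have h1 : ε ≤ η := by
    have := Real.log_le_sub_one_of_pos (show 0 < 1 - ε₀ by linarith)
    linarith
  have h2 : -Real.log (1 - ε) ≤ η :=
    neg_le_neg (Real.log_le_log (by linarith) (by linarith))
  have hη0 : 0 < η := hε.trans_le h1
  obtain ⟨n, rfl⟩ : ∃ n, τ = n + 1 := ⟨τ - 1, by omega⟩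
  rw [Nat.add_sub_cancel] at hk
  calc -Real.log (1 - ε) ≤ 1 * η := by linarith
    _ ≤ (1 / ε ^ n * η ^ n) * η := by
        gcongr
        rw [one_div_mul_eq_div, one_le_div (by positivity)]
        gcongr
    _ ≤ (k * η ^ n) * η := by gcongr
    _ = k * η ^ (n + 1) := by ring

lemma rpow_mul_rpow_div {d : ℕ} {α β r : ℝ} (hα : 0 < α) (hβ : 0 < β) (hr : 0 ≤ r) :
    (β * r ^ α) ^ ((d : ℝ) / α) = β ^ ((d : ℝ) / α) * r ^ d := by
  rw [Real.mul_rpow hβ.le (by positivity), ← Real.rpow_mul hr, mul_div_cancel₀ _ hα.ne',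
    Real.rpow_natCast]

lemma rho_mul_div_eq {ε k : ℝ} {τ : ℕ} (hτ : 1 ≤ τ) (hε : 0 < ε) (hk : 0 < k) (D : ℝ) :
    rho ε τ * (τ : ℝ) ^ 2 / (D * k ^ (1 / (τ : ℝ))) =
      (ε * (τ + 1) / k) ^ (1 / (τ : ℝ)) / D := by
  have h : (τ : ℝ) ≠ 0 := by positivity
  rw [rho, Real.div_rpow (by positivity) hk.le, div_mul_cancel₀ _ (by positivity), div_div,
    mul_comm D]

/-! ### Bounds on the feasible intensities. -/

namespace Network

variable {Ω : Type*} [MeasurableSpace Ω] {P : Measure Ω} {d m : ℕ}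

/-- The intensity is chosen so that the upper bound for the mean miss probability equals `ε / k`;
then `ε ≤ -log (1 - ε)` suffices. -/
lemma mem_feasible_of_failure_le [IsProbabilityMeasure P] (net : Network Ω P d m) (hd : 0 < d)
    {α : ℝ} (hα : 0 < α) {C : ℝ} (hC : 0 < C)
    (hfail : ∀ lam x i, 0 < lam → 0 < x →
      P.real (net.failureEvent α x lam i) ≤ C * (lam * x ^ ((d : ℝ) / α)))
    {τ : ℕ} {s β lamr ε : ℝ} (hτ : 1 ≤ τ) (hs : 0 < s) (hβ : 0 < β)
    (hk : 0 < clusterVolume d s * lamr) (hε : 0 < ε) (hε1 : ε < 1) :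
    (ε * (τ + 1) / (clusterVolume d s * lamr)) ^ (1 / (τ : ℝ)) /
      (C * (β ^ ((d : ℝ) / α) * s ^ d)) ∈ net.feasible α β s lamr τ ε := by
  set k := clusterVolume d s * lamr
  set T := (ε * (τ + 1) / k) ^ (1 / (τ : ℝ)) with hT
  have hT0 : 0 < T := by positivity
  have hTτ : T ^ τ = ε * (τ + 1) / k := by
    rw [hT, one_div]
    exact Real.rpow_inv_natCast_pow (by positivity) (by omega)
  set lam := T / (C * (β ^ ((d : ℝ) / α) * s ^ d)) with hlam
  have hlam0 : 0 < lam := by positivity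
  refine (net.mem_feasible_iff hd hα hβ hs lamr τ hε1).2 ⟨hlam0, ?_⟩
  have h := net.meanMissProb_le hd hα hβ hs (lam := lam) (A := C * (lam * β ^ ((d : ℝ) / α)))
    (τ := τ) fun r hr i => by
      refine (hfail lam (β * r ^ α) i hlam0 (by positivity)).trans_eq ?_
      rw [rpow_mul_rpow_div hα hβ hr.le]
      ring
  have h1 : C * (lam * β ^ ((d : ℝ) / α)) * s ^ d = T := by
    rw [hlam]
    field_simp
  rw [h1, hTτ] at h
  calc k * net.meanMissProb α β s lam τ ≤ k * (ε * (τ + 1) / k / (τ + 1)) := by gcongr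
    _ = ε := by field_simp
    _ ≤ -Real.log (1 - ε) := by
      have := Real.log_le_sub_one_of_pos (show 0 < 1 - ε by linarith)
      linarith

/-- A feasible intensity is so small that attempts do not fail almost surely near the boundary of
the cluster. -/
lemma le_inv_of_mem_feasible [IsProbabilityMeasure P] (net : Network Ω P d m) (hd : 0 < d)
    {α : ℝ} (hα : 0 < α) {c w : ℝ} (hc : 0 < c) (hw : 0 < w) (hw1 : w < 1)
    {τ : ℕ} {s β lam lamr ε ε₀ : ℝ} (hτ : 1 ≤ τ) (hs : 0 < s) (hβ : 0 < β)
    (hfail : ∀ x i, β * (w * s) ^ α ≤ x →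
      (1 - w) * (1 - Real.exp (-(c * (lam * x ^ ((d : ℝ) / α))))) ≤
        P.real (net.failureEvent α x lam i))
    (hε : 0 < ε) (hεε₀ : ε ≤ ε₀) (hε₀ : ε₀ < 1) (hη : -Real.log (1 - ε₀) = 1 - 4 * w)
    (hk : 1 / ε ^ (τ - 1) ≤ clusterVolume d s * lamr)
    (hmem : lam ∈ net.feasible α β s lamr τ ε) :
    c * (lam * β ^ ((d : ℝ) / α)) * s ^ d ≤ 1 / (w * w ^ d) := by
  obtain ⟨hlam, hle⟩ := (net.mem_feasible_iff hd hα hβ hs lamr τ (by linarith)).1 hmem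
  set k := clusterVolume d s * lamr
  have hk0 : 0 < k := lt_of_lt_of_le (by positivity) hk
  set y := c * (lam * β ^ ((d : ℝ) / α)) * s ^ d * w ^ d with hy
  have hy0 : 0 < y := by positivity
  -- `y` is the exponent of the failure bound at radius `w * s`. If `exp (-y) < w`, each attempt
  -- beyond that radius fails with probability at least `(1 - w) ^ 2`.
  have hexp : w ≤ Real.exp (-y) := by
    by_contra! hlt
    have h1 := net.le_meanMissProb hd hα hβ hs (lam := lam) (B := ((1 - w) ^ 2) ^ τ) (κ := w)
      (τ := τ) (n := 0) hw.le hw1.le (by positivity) fun r hr hrs => by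
        rw [pow_zero, mul_one]
        refine net.pow_le_missProb (by positivity) fun i => ?_
        have hr0 : 0 < r := lt_of_lt_of_le (by positivity) hr
        have h2 := hfail (β * r ^ α) i (by gcongr)
        refine le_trans ?_ h2
        rw [rpow_mul_rpow_div hα hβ hr0.le, sq]
        have h3 : Real.exp (-(c * (lam * (β ^ ((d : ℝ) / α) * r ^ d)))) ≤ Real.exp (-y) := by
          rw [Real.exp_le_exp, neg_le_neg_iff, hy]
          calc c * (lam * β ^ ((d : ℝ) / α)) * s ^ d * w ^ d
              = c * (lam * (β ^ ((d : ℝ) / α) * (w * s) ^ d)) := by ring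
            _ ≤ _ := by gcongr
        exact mul_le_mul_of_nonneg_left (by linarith) (by linarith)
    rw [pow_zero, mul_one, Nat.cast_zero, zero_add, div_one] at h1
    have hη0 : 0 < -Real.log (1 - ε₀) :=
      neg_pos.2 (Real.log_neg (by linarith) (by linarith))
    -- Two factors `1 - w` come from the failure bound, the third from the discarded radii.
    have h4 : (1 - 4 * w) ^ τ < ((1 - w) ^ 3) ^ τ :=
      pow_lt_pow_left₀ (by nlinarith [sq_nonneg w, pow_pos hw 3]) (by linarith) (by omega)
    have h5 : ((1 - w) ^ 3) ^ τ ≤ ((1 - w) ^ 2) ^ τ * (1 - w) := by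
      rw [pow_succ (1 - w) 2, mul_pow]
      gcongr
      exact pow_le_of_le_one (by linarith) (by linarith) (by omega)
    have h6 := neg_log_one_sub_le_mul_pow hτ hε hεε₀ hε₀ hk
    rw [hη] at h6
    have h7 : k * (1 - 4 * w) ^ τ < k * net.meanMissProb α β s lam τ := by
      gcongr
      linarith
    linarith
  have h8 : y ≤ 1 / w := by
    have h9 := Real.add_one_le_exp y
    rw [le_div_iff₀ hw]
    calc y * w ≤ Real.exp y * Real.exp (-y) := by gcongr; linarith
      _ = 1 := by rw [← Real.exp_add, add_neg_cancel, Real.exp_zero]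
  -- Passing from radius `w * s` to `s` costs the factor `w ^ d`.
  rw [← div_div, le_div_iff₀ (by positivity)]
  exact h8

/-- Since `le_inv_of_mem_feasible` bounds the exponent by a constant `Y`, the failure probability is
at least linear: `1 - exp (-y) ≥ y / (1 + y) ≥ y / (1 + Y)`. Averaging the `τ`-th power and taking
the root gives the bound. -/
lemma le_of_mem_feasible [IsProbabilityMeasure P] (net : Network Ω P d m) (hd : 0 < d)
    {α : ℝ} (hα : 0 < α) {c w : ℝ} (hc : 0 < c) (hw : 0 < w) (hw1 : w < 1)
    {τ : ℕ} {s β lam lamr ε ε₀ : ℝ} (hτ : 1 ≤ τ) (hs : 0 < s) (hβ : 0 < β)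
    (hfail : ∀ x i, β * (w * s) ^ α ≤ x →
      (1 - w) * (1 - Real.exp (-(c * (lam * x ^ ((d : ℝ) / α))))) ≤
        P.real (net.failureEvent α x lam i))
    (hε : 0 < ε) (hεε₀ : ε ≤ ε₀) (hε₀ : ε₀ < 1) (hη : -Real.log (1 - ε₀) = 1 - 4 * w)
    (hk : 1 / ε ^ (τ - 1) ≤ clusterVolume d s * lamr)
    (hmem : lam ∈ net.feasible α β s lamr τ ε) :
    lam ≤ (1 + 1 / (w * w ^ d)) / ((1 - w) * (1 - w) * c * (1 - ε₀)) *
      ((ε * (τ + 1) / (clusterVolume d s * lamr)) ^ (1 / (τ : ℝ)) /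
        (β ^ ((d : ℝ) / α) * s ^ d)) := by
  have hL := net.le_inv_of_mem_feasible hd hα hc hw hw1 hτ hs hβ hfail hε hεε₀ hε₀ hη hk hmem
  obtain ⟨hlam, hle⟩ := (net.mem_feasible_iff hd hα hβ hs lamr τ (by linarith)).1 hmem
  set k := clusterVolume d s * lamr
  have hk0 : 0 < k := lt_of_lt_of_le (by positivity) hk
  set Y := 1 / (w * w ^ d) with hY
  have hY0 : 0 < Y := by positivity
  have hw1' : 0 < 1 - w := by linarith
  have hε₀' : 0 < 1 - ε₀ := by linarith
  set A := (1 - w) * (c * (lam * β ^ ((d : ℝ) / α)) / (1 + Y)) with hA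
  have hA0 : 0 < A := by positivity
  have h1 := net.le_meanMissProb hd hα hβ hs (lam := lam) (B := A ^ τ) (κ := w)
    (τ := τ) (n := τ) hw.le hw1.le (by positivity) fun r hr hrs => by
      have hr0 : 0 < r := lt_of_lt_of_le (by positivity) hr
      rw [← mul_pow]
      refine net.pow_le_missProb (by positivity) fun i => ?_
      refine le_trans ?_ (hfail (β * r ^ α) i (by gcongr))
      rw [rpow_mul_rpow_div hα hβ hr0.le]
      have hyY : c * (lam * (β ^ ((d : ℝ) / α) * r ^ d)) ≤ Y := by
        refine le_trans ?_ hL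
        calc c * (lam * (β ^ ((d : ℝ) / α) * r ^ d))
            = c * (lam * β ^ ((d : ℝ) / α)) * r ^ d := by ring
          _ ≤ _ := by gcongr
      have hy0 : 0 < c * (lam * (β ^ ((d : ℝ) / α) * r ^ d)) := by positivity
      calc A * r ^ d = (1 - w) * (c * (lam * (β ^ ((d : ℝ) / α) * r ^ d)) / (1 + Y)) := by
            rw [hA]; ring
        _ ≤ (1 - w) * (c * (lam * (β ^ ((d : ℝ) / α) * r ^ d)) /
              (1 + c * (lam * (β ^ ((d : ℝ) / α) * r ^ d)))) := by gcongr
        _ ≤ _ := by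
            gcongr
            exact div_one_add_le_one_sub_exp_neg hy0.le
  -- The single factors `1 - w` and `1 - ε₀` are weakened to `τ`-th powers, so that the root leaves
  -- constants free of `τ`.
  have h2 : (1 - w) ^ τ ≤ 1 - w := pow_le_of_le_one hw1'.le (by linarith) (by omega)
  have h3 : (1 - ε₀) ^ τ ≤ 1 - ε₀ := pow_le_of_le_one hε₀'.le (by linarith) (by omega)
  have h4 : -Real.log (1 - ε) ≤ ε / (1 - ε₀) ^ τ := by
    refine (neg_log_one_sub_le (by linarith)).trans ?_
    gcongr
    linarith
  have h5 : (A * s ^ d * (1 - w) * (1 - ε₀)) ^ τ ≤ ε * (τ + 1) / k := by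
    have h6 : k * (A ^ τ * (s ^ d) ^ τ * (1 - w) ^ τ / (τ + 1)) ≤ ε / (1 - ε₀) ^ τ := by
      refine le_trans ?_ (hle.trans h4)
      refine mul_le_mul_of_nonneg_left (le_trans ?_ h1) hk0.le
      gcongr
    rw [le_div_iff₀ (by positivity)] at h6
    rw [le_div_iff₀ hk0, mul_pow, mul_pow, mul_pow]
    have hτ1 : (0 : ℝ) < τ + 1 := by positivity
    calc A ^ τ * (s ^ d) ^ τ * (1 - w) ^ τ * (1 - ε₀) ^ τ * k
        = k * (A ^ τ * (s ^ d) ^ τ * (1 - w) ^ τ / (τ + 1)) * (1 - ε₀) ^ τ * (τ + 1) := by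
          field_simp
      _ ≤ ε * (τ + 1) := by gcongr
  have h7 : A * s ^ d * (1 - w) * (1 - ε₀) ≤ (ε * (τ + 1) / k) ^ (1 / (τ : ℝ)) := by
    rw [one_div, Real.le_rpow_inv_iff_of_pos (by positivity) (by positivity)
      (by exact_mod_cast hτ), Real.rpow_natCast]
    exact h5
  calc lam = (1 + Y) / ((1 - w) * (1 - w) * c * (1 - ε₀)) *
        (A * s ^ d * (1 - w) * (1 - ε₀) / (β ^ ((d : ℝ) / α) * s ^ d)) := by
        rw [hA]
        field_simp
    _ ≤ _ := by gcongr

end Network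

end Multicast

/-! ### Choice of constants and conclusion. -/

theorem theorem1 (d m : ℕ) (hd : 0 < d) (hm : 0 < m) (α : ℝ) (hα : (d : ℝ) < α)
    (β₀ : ℝ) (hβ₀ : 0 < β₀) (ε₀ : ℝ) (hε₀ : 0 < ε₀) (hε₀' : ε₀ < 1 - Real.exp (-1)) :
    ∃ c C : ℝ, 0 < c ∧ 0 < C ∧
      ∀ (Ω : Type*) [MeasurableSpace Ω] (P : Measure Ω) [IsProbabilityMeasure P]
        (net : Multicast.Network Ω P d m) (τ : ℕ) (s β lamr ε : ℝ),
        1 ≤ τ → 1 ≤ s → 0 < β → β₀ ≤ β * s ^ α → 0 < lamr → 0 < ε → ε ≤ ε₀ →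
        1 / ε ^ (τ - 1) ≤ Multicast.clusterVolume d s * lamr →
        (net.feasible α β s lamr τ ε).Nonempty ∧
        BddAbove (net.feasible α β s lamr τ ε) ∧
        c * (Multicast.rho ε τ * (τ : ℝ) ^ 2 /
            (β ^ ((d : ℝ) / α) * Multicast.clusterVolume d s *
              (Multicast.clusterVolume d s * lamr) ^ (1 / (τ : ℝ))))
          ≤ net.maxContentionIntensity α β s lamr τ ε ∧
        net.maxContentionIntensity α β s lamr τ ε ≤
          C * (Multicast.rho ε τ * (τ : ℝ) ^ 2 /
            (β ^ ((d : ℝ) / α) * Multicast.clusterVolume d s *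
              (Multicast.clusterVolume d s * lamr) ^ (1 / (τ : ℝ)))) := by
  have hα0 : 0 < α := (Nat.cast_nonneg d).trans_lt hα
  have hε₀1 : ε₀ < 1 := by linarith [Real.exp_pos (-1)]
  have hη0 : 0 < -Real.log (1 - ε₀) := neg_pos.2 (Real.log_neg (by linarith) (by linarith))
  have hη1 : -Real.log (1 - ε₀) < 1 := by
    rw [neg_lt, Real.lt_log_iff_exp_lt (by linarith)]
    linarith
  -- With this `w`, `(1 - w) ^ 3 > 1 - 4 * w = -log (1 - ε₀)`. Positivity of `w` is exactly `ε₀ < 1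
  -- - e⁻¹`.
  obtain ⟨w, hw⟩ : ∃ w, w = (1 - -Real.log (1 - ε₀)) / 4 := ⟨_, rfl⟩
  have hw0 : 0 < w := by linarith
  have hw1 : w < 1 := by linarith
  have hη : -Real.log (1 - ε₀) = 1 - 4 * w := by linarith
  obtain ⟨C₁, hC₁, hupper⟩ := Multicast.exists_measure_failureEvent_le hm hα
  -- `β₀ * w ^ α` bounds `β * r ^ α` from below for all `r ≥ w * s`.
  obtain ⟨c₁, hc₁, hlower⟩ := Multicast.exists_le_measure_failureEvent hd hm hα0 hw0
    (show 0 < β₀ * w ^ α by positivity)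
  have hv := Multicast.unitBallVolume_pos d
  have hw1' : 0 < 1 - w := by linarith
  have hε₀1' : 0 < 1 - ε₀ := by linarith
  refine ⟨Multicast.unitBallVolume d / C₁, (1 + 1 / (w * w ^ d)) /
    ((1 - w) * (1 - w) * c₁ * (1 - ε₀)) * Multicast.unitBallVolume d, by positivity,
    by positivity, ?_⟩
  intro Ω _ P _ net τ s β lamr ε hτ hs hβ hβs hlamr hε hεε₀ hk
  have hs0 : 0 < s := by linarith
  have hk0 : 0 < Multicast.clusterVolume d s * lamr := lt_of_lt_of_le (by positivity) hk
  have hmem := net.mem_feasible_of_failure_le hd hα0 hC₁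
    (fun lam x i => hupper Ω P net lam x i) hτ hs0 hβ hk0 hε (by linarith)
  rw [Multicast.rho_mul_div_eq hτ hε hk0]
  set T := (ε * (τ + 1) / (Multicast.clusterVolume d s * lamr)) ^ (1 / (τ : ℝ))
  have hub : ∀ lam ∈ net.feasible α β s lamr τ ε, lam ≤ (1 + 1 / (w * w ^ d)) /
      ((1 - w) * (1 - w) * c₁ * (1 - ε₀)) * Multicast.unitBallVolume d *
      (T / (β ^ ((d : ℝ) / α) * Multicast.clusterVolume d s)) := by
    intro lam hlam
    refine (net.le_of_mem_feasible hd hα0 hc₁ hw0 hw1 hτ hs0 hβ (fun x i hx => ?_) hε hεε₀ hε₀1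
      hη hk hlam).trans_eq ?_
    · refine hlower Ω P net lam x i hlam.1 (le_trans ?_ hx)
      rw [Real.mul_rpow hw0.le hs0.le]
      calc β₀ * w ^ α ≤ β * s ^ α * w ^ α := by gcongr
        _ = _ := by ring
    · change _ * (T / _) = _
      rw [Multicast.clusterVolume_eq hs0]
      field_simp
  refine ⟨⟨_, hmem⟩, ⟨_, hub⟩, ?_, csSup_le ⟨_, hmem⟩ hub⟩
  refine le_trans (le_of_eq ?_) (le_csSup ⟨_, hub⟩ hmem)
  rw [Multicast.clusterVolume_eq hs0]
  field_simp
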